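/- **Definitions.** A conformal algebra is a $\mathbb C[\partial]$-module $C$ with $\mathbb C$-bilinear products $(a,b)\mapsto a_{(n)}b$, $n\in\mathbb Z_{\ge 0}$, such that for all $a,b\in C$: $a_{(n)}b=0$ for $n$ sufficiently large; $\partial(a_{(n)}b)=(\partial a)_{(n)}b+a_{(n)}(\partial b)$; and $(\partial a)_{(n)}b=-n\,a_{(n-1)}b$ (read as $0$ for $n=0$). It is associative if $f_{(m)}(g_{(n)}h)=\sum_{j=0}^{m}\binom mj (f_{(j)}g)_{(m+n-j)}h$ for all $f,g,h\in C$ and $m,n\ge 0$. It is unital if it contains a conformal identity, i.e. an element $e$ such that $e_{(0)}f=f$ for all $f\in C$ and the degree of locality of $e$ with itself, the least $N\ge 0$ with $e_{(n)}e=0$ for all $n\ge N$, is $1$. An ideal is a $\mathbb C[\partial]$-submodule $I$ with $a_{(n)}x,\ x_{(n)}a\in I$ for all $a\in C$, $x\in I$, $n\ge 0$. $C$ is simple if its products are not all zero and its only ideals are $0$ and $C$. For an associative $\mathbb C$-algebra $A$ with identity, the current algebra $\mathrm{Cur}(A)$ is the conformal algebra $\mathbb C[\partial]\otimes_{\mathbb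 C}A$ whose products are determined by $(1\otimes a)_{(0)}(1\otimes b)=1\otimes ab$ and $(1\otimes a)_{(n)}(1\otimes b)=0$ for $n>0$. An isomorphism of conformal algebras is a $\mathbb C[\partial]$-linear bijection preserving all products. **Theorem.** Let $C$ be a simple unital associative conformal algebra that is finitely generated as a $\mathbb C[\partial]$-module. Then there is an integer $n\ge 1$ such that $C$ is isomorphic, as a conformal algebra, to $\mathrm{Cur}(\mathrm{Mat}_n(\mathbb C))$. Conversely, every conformal algebra isomorphic to $\mathrm{Cur}(\mathrm{Mat}_n(\mathbb C))$ with $n\ge 1$ is associative, unital, simple and finitely generated as a $\mathbb C[\partial]$-module. -/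

import Mathlib

open scoped Polynomial TensorProduct

noncomputable section

/-- A conformal algebra: a `ℂ[∂]`-module `C`, where `∂` acts as the indeterminate
`X` of `ℂ[X]`, with `ℂ`-bilinear products `prod n a b` (the `n`-th product of `a` and `b`),
`n = 0, 1, 2, …`, which satisfy locality, the Leibniz rule for `∂`, and
`(∂ a)₍ₙ₎ b = - n a₍ₙ₋₁₎ b` (which is `0` for `n = 0`). -/
class ConformalAlgebra (C : Type*) [AddCommGroup C] [Module ℂ C] [Module ℂ[X] C]
    [IsScalarTower ℂ ℂ[X] C] where
  prod : ℕ → C →ₗ[ℂ] C →ₗ[ℂ] C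
  locality : ∀ a b : C, ∃ N : ℕ, ∀ n, N ≤ n → prod n a b = 0
  leibniz : ∀ (n : ℕ) (a b : C), (Polynomial.X : ℂ[X]) • prod n a b =
    prod n ((Polynomial.X : ℂ[X]) • a) b + prod n a ((Polynomial.X : ℂ[X]) • b)
  prod_deriv_left : ∀ (n : ℕ) (a b : C),
    prod n ((Polynomial.X : ℂ[X]) • a) b = -(n : ℂ) • prod (n - 1) a b

namespace ConformalAlgebra

section

variable (C : Type*) [AddCommGroup C] [Module ℂ C] [Module ℂ[X] C] [IsScalarTower ℂ ℂ[X] C]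
  [ConformalAlgebra C]

/-- Associativity:
`f₍ₘ₎ (g₍ₙ₎ h) = ∑ⱼ (m choose j) (f₍ⱼ₎ g)₍ₘ₊ₙ₋ⱼ₎ h`. The terms with `j > m` vanish. -/
def IsAssociative : Prop :=
  ∀ (m n : ℕ) (f g h : C), prod m f (prod n g h) =
    ∑ j ∈ Finset.range (m + 1), (m.choose j : ℂ) • prod (m + n - j) (prod j f g) h

variable {C} in
/-- The degree of locality of `a` and `b`: the least `N` such that
`a₍ₙ₎ b = 0` for all `n ≥ N`. Such an `N` exists by the locality axiom. -/
def localityDegree (a b : C) : ℕ :=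
  sInf {N : ℕ | ∀ n, N ≤ n → prod n a b = 0}

variable {C} in
/-- A conformal identity: `e₍₀₎ f = f` for all `f`, and the degree of locality of `e` with
itself is `1`. -/
def IsConformalIdentity (e : C) : Prop :=
  (∀ f : C, prod 0 e f = f) ∧ localityDegree e e = 1

/-- A conformal algebra is unital if it has a conformal identity. -/
def IsUnital : Prop := ∃ e : C, IsConformalIdentity e

variable {C} in
/-- A conformal ideal: a `ℂ[∂]`-submodule closed under all left and right
multiplications, of any order, by elements of the algebra. -/
def IsIdeal (I : Submodule ℂ[X] C) : Prop :=
  ∀ (n : ℕ) (a : C), ∀ x ∈ I, prod n a x ∈ I ∧ prod n x a ∈ I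

/-- A conformal algebra is simple if its products are not all zero and its only ideals are
zero and the whole algebra. -/
def IsSimple : Prop :=
  (∃ (n : ℕ) (a b : C), prod n a b ≠ 0) ∧
    ∀ I : Submodule ℂ[X] C, IsIdeal I → I = ⊥ ∨ I = ⊤

/-- An isomorphism of conformal algebras: a `ℂ[∂]`-linear bijection that preserves all
products. -/
structure Iso (C : Type*) [AddCommGroup C] [Module ℂ C] [Module ℂ[X] C]
    [IsScalarTower ℂ ℂ[X] C] [ConformalAlgebra C]
    (D : Type*) [AddCommGroup D] [Module ℂ D] [Module ℂ[X] D]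
    [IsScalarTower ℂ ℂ[X] D] [ConformalAlgebra D] extends C ≃ₗ[ℂ[X]] D where
  map_prod : ∀ (n : ℕ) (a b : C), toFun (prod n a b) = prod n (toFun a) (toFun b)

end

/-! ### Current algebras -/

/-- The products of the current algebra of `ℂ`, on `ℂ[∂]`: the `n`-th product of `p` and `q`
is `∑ᵢ (n choose i) (-1)ⁱ p⁽ⁱ⁾(0) q⁽ⁿ⁻ⁱ⁾(∂)`, that is, `n!` times the coefficient of `λⁿ`
in `p(-λ) q(∂ + λ)`. -/
def polyProd (n : ℕ) : ℂ[X] →ₗ[ℂ] ℂ[X] →ₗ[ℂ] ℂ[X] :=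
  LinearMap.mk₂ ℂ
    (fun p q => ∑ i ∈ Finset.range (n + 1),
      ((n.choose i : ℂ) * (-1) ^ i * (Polynomial.derivative^[i] p).eval 0) •
        Polynomial.derivative^[n - i] q)
    (fun p p' q => by
      simp only [iterate_map_add, Polynomial.eval_add, mul_add, add_smul,
        Finset.sum_add_distrib])
    (fun c p q => by
      simp only [Polynomial.iterate_derivative_smul, Polynomial.eval_smul, Finset.smul_sum,
        smul_smul, smul_eq_mul]
      refine Finset.sum_congr rfl fun i _ => ?_
      congr 1
      ring)
    (fun p q q' => by
      simp only [iterate_map_add, smul_add, Finset.sum_add_distrib])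
    (fun c p q => by
      simp only [Polynomial.iterate_derivative_smul, Finset.smul_sum]
      refine Finset.sum_congr rfl fun i _ => ?_
      rw [smul_comm])

theorem polyProd_apply (n : ℕ) (p q : ℂ[X]) :
    polyProd n p q = ∑ i ∈ Finset.range (n + 1),
      ((n.choose i : ℂ) * (-1) ^ i * (Polynomial.derivative^[i] p).eval 0) •
        Polynomial.derivative^[n - i] q := rfl

theorem iterate_derivative_X_mul' (k : ℕ) (p : ℂ[X]) :
    Polynomial.derivative^[k] (Polynomial.X * p) =
      Polynomial.X * Polynomial.derivative^[k] p +
        (k : ℂ) • Polynomial.derivative^[k - 1] p := by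
  induction k with
  | zero => simp
  | succ k ih =>
    rw [Function.iterate_succ_apply', ih]
    rcases k with _ | k
    · simp [add_comm]
    · simp only [Polynomial.derivative_add, Polynomial.derivative_mul, Polynomial.derivative_X,
        Polynomial.derivative_smul, Nat.add_sub_cancel, ← Function.iterate_succ_apply',
        Nat.cast_add, Nat.cast_one, add_smul, one_smul, one_mul]
      ring

theorem polyProd_X_mul_left (n : ℕ) (p q : ℂ[X]) :
    polyProd n (Polynomial.X * p) q = -(n : ℂ) • polyProd (n - 1) p q := by
  rcases n with _ | n
  · simp [polyProd_apply]
  · rw [polyProd_apply, polyProd_apply, Finset.sum_range_succ', Finset.smul_sum]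
    simp only [iterate_derivative_X_mul', Nat.add_sub_cancel, Nat.add_sub_add_right]
    simp only [Polynomial.eval_add, Polynomial.eval_mul, Polynomial.eval_X, zero_mul,
      Polynomial.eval_smul, zero_add, smul_smul, smul_eq_mul, Nat.cast_zero, mul_zero,
      zero_smul, add_zero]
    refine Finset.sum_congr rfl fun i _ => ?_
    congr 1
    have h : ((n + 1 : ℕ) : ℂ) * (n.choose i : ℂ) =
        ((n + 1).choose (i + 1) : ℂ) * ((i + 1 : ℕ) : ℂ) := by
      exact_mod_cast Nat.add_one_mul_choose_eq n i
    rw [pow_succ]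
    linear_combination ((-1) ^ i * (Polynomial.derivative^[i] p).eval 0) * h

theorem polyProd_X_mul_right (n : ℕ) (p q : ℂ[X]) :
    polyProd n p (Polynomial.X * q) =
      Polynomial.X * polyProd n p q + (n : ℂ) • polyProd (n - 1) p q := by
  rcases n with _ | n
  · simp [polyProd_apply]
  · rw [polyProd_apply, polyProd_apply, polyProd_apply, Finset.mul_sum, Finset.smul_sum]
    simp only [iterate_derivative_X_mul', smul_add, Finset.sum_add_distrib,
      mul_smul_comm, Nat.add_sub_cancel]
    congr 1
    rw [Finset.sum_range_succ]
    simp only [Nat.sub_self, Nat.cast_zero, zero_smul, smul_zero, add_zero]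
    refine Finset.sum_congr rfl fun i hi => ?_
    have hi' : i ≤ n := Nat.lt_succ_iff.mp (Finset.mem_range.mp hi)
    have e : n + 1 - i - 1 = n - i := by omega
    rw [e, smul_smul, smul_smul]
    congr 1
    have h : (n.choose i : ℂ) * ((n + 1 : ℕ) : ℂ) =
        ((n + 1).choose i : ℂ) * ((n + 1 - i : ℕ) : ℂ) := by
      exact_mod_cast Nat.choose_mul_succ_eq n i
    linear_combination -((-1) ^ i * (Polynomial.derivative^[i] p).eval 0) * h

theorem polyProd_leibniz (n : ℕ) (p q : ℂ[X]) :
    Polynomial.X * polyProd n p q =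
      polyProd n (Polynomial.X * p) q + polyProd n p (Polynomial.X * q) := by
  rw [polyProd_X_mul_left, polyProd_X_mul_right, neg_smul]
  abel

theorem polyProd_eq_zero (n : ℕ) (p q : ℂ[X]) (h : p.natDegree + q.natDegree < n) :
    polyProd n p q = 0 := by
  rw [polyProd_apply]
  refine Finset.sum_eq_zero fun i _ => ?_
  by_cases hi : p.natDegree < i
  · rw [Polynomial.iterate_derivative_eq_zero hi]
    simp
  · rw [Polynomial.iterate_derivative_eq_zero (p := q) (by omega), smul_zero]

/-- The underlying `ℂ[∂]`-module of the current algebra over an associative `ℂ`-algebra `A`: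
the free module `ℂ[∂] ⊗ A`. The element `1 ⊗ a` is the formal distribution
`∑ₙ a tⁿ z⁻ⁿ⁻¹`. -/
abbrev Cur (A : Type*) [Ring A] [Algebra ℂ A] : Type _ := ℂ[X] ⊗[ℂ] A

/-- The products of the current algebra:
`(p ⊗ a)₍ₙ₎ (q ⊗ b) = polyProd n p q ⊗ ab`. -/
def curProd (A : Type*) [Ring A] [Algebra ℂ A] (n : ℕ) :
    Cur A →ₗ[ℂ] Cur A →ₗ[ℂ] Cur A :=
  TensorProduct.map₂ (polyProd n) (LinearMap.mul ℂ A)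

theorem curProd_tmul (A : Type*) [Ring A] [Algebra ℂ A] (n : ℕ) (p q : ℂ[X]) (a b : A) :
    curProd A n (p ⊗ₜ a) (q ⊗ₜ b) = polyProd n p q ⊗ₜ (a * b) := rfl

/-- The current conformal algebra over an associative `ℂ`-algebra `A`. -/
instance instCur (A : Type*) [Ring A] [Algebra ℂ A] : ConformalAlgebra (Cur A) where
  prod := curProd A
  locality a b := by
    induction a using TensorProduct.induction_on with
    | zero => exact ⟨0, fun n _ => by simp⟩
    | add x y hx hy =>
      obtain ⟨N, hN⟩ := hx
      obtain ⟨M, hM⟩ := hy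
      refine ⟨max N M, fun n hn => ?_⟩
      rw [map_add, LinearMap.add_apply, hN n (le_of_max_le_left hn),
        hM n (le_of_max_le_right hn), add_zero]
    | tmul p x =>
      induction b using TensorProduct.induction_on with
      | zero => exact ⟨0, fun n _ => by simp⟩
      | add y z hy hz =>
        obtain ⟨N, hN⟩ := hy
        obtain ⟨M, hM⟩ := hz
        refine ⟨max N M, fun n hn => ?_⟩
        rw [map_add, hN n (le_of_max_le_left hn), hM n (le_of_max_le_right hn), add_zero]
      | tmul q y =>
        refine ⟨p.natDegree + q.natDegree + 1, fun n hn => ?_⟩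
        rw [curProd_tmul, polyProd_eq_zero n p q (by omega), TensorProduct.zero_tmul]
  leibniz n a b := by
    induction a using TensorProduct.induction_on with
    | zero => simp
    | add x y hx hy =>
      simp only [map_add, LinearMap.add_apply, smul_add, hx, hy]
      abel
    | tmul p x =>
      induction b using TensorProduct.induction_on with
      | zero => simp
      | add y z hy hz =>
        simp only [map_add, smul_add, hy, hz]
        abel
      | tmul q y =>
        simp only [TensorProduct.smul_tmul', smul_eq_mul, curProd_tmul]
        rw [polyProd_leibniz, TensorProduct.add_tmul]
  prod_deriv_left n a b := by
    induction a using TensorProduct.induction_on with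
    | zero => simp
    | add x y hx hy =>
      simp only [map_add, LinearMap.add_apply, smul_add, hx, hy]
    | tmul p x =>
      induction b using TensorProduct.induction_on with
      | zero => simp
      | add y z hy hz =>
        simp only [map_add, smul_add, hy, hz]
      | tmul q y =>
        simp only [TensorProduct.smul_tmul', smul_eq_mul, curProd_tmul]
        rw [polyProd_X_mul_left]

/-- The products of the generators: `(1 ⊗ a)₍₀₎ (1 ⊗ b) = 1 ⊗ ab`, and
`(1 ⊗ a)₍ₙ₎ (1 ⊗ b) = 0` for `n > 0`. With the axioms they determine all products. -/
theorem cur_prod_generators (A : Type*) [Ring A] [Algebra ℂ A] (n : ℕ) (a b : A) :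
    prod n ((1 : ℂ[X]) ⊗ₜ[ℂ] a : Cur A) ((1 : ℂ[X]) ⊗ₜ[ℂ] b : Cur A) =
      if n = 0 then (1 : ℂ[X]) ⊗ₜ[ℂ] (a * b) else 0 := by
  change curProd A n _ _ = _
  rw [curProd_tmul]
  split_ifs with h
  · subst h
    simp [polyProd_apply]
  · rw [polyProd_eq_zero n 1 1 (by simp; omega), TensorProduct.zero_tmul]

end ConformalAlgebra

end

/-! Let D = e₍₁₎ be the first product with the conformal identity. Then [D, ∂] = 1 and D is locally
nilpotent, so by integrating polynomials C is generated over ℂ[∂] by ker D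
(`IsWeylOperator.span_ker`). The operators a₍₀₎ form an algebra S (`zeroModes`), finite-dimensional
because (∂a)₍₀₎ = 0, and δ = [D, ·] is a derivation of S.

A δ-stable ideal J of S yields the conformal ideal J·C, so J is 0 or S. In characteristic zero this
makes S simple (`IsSimpleRing.of_derivation`): the radical of the trace form is δ-stable, hence
zero, and every ideal of a semisimple algebra is stable under all derivations. So S is a matrix
algebra over ℂ and δ is inner.

D itself need not commute with S. Local nilpotency of D leaves δ only the eigenvalue 0, so δ = [y,
·] with y ∈ S nilpotent, and D' = D - y has the same properties as D and commutes with S. For v ∈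
ker D' one has v₍ₙ₊₁₎ = D' v₍ₙ₎; since the left annihilator of C is zero, v ↦ v₍₀₎ is a bijection
from ker D' to S. It carries the zeroth product to multiplication, and the higher products vanish on
ker D'. The resulting map Cur(S) → C is onto, and injective because Cur(S) is simple
(`IsWeylOperator.nonempty_iso_cur`).

For the converse, associativity passes through ∂ in each argument and is checked on the generators 1
⊗ a; simplicity comes from extracting a ∂-coefficient of an element with products by 1 ⊗ 1. -/

section DerivationSimple

/-! ### Derivations and simplicity of finite-dimensional algebras -/

variable {K R : Type*} [Field K] [Ring R] [Algebra K R]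

/-- The radical of the trace form of a finite-dimensional algebra. -/
def traceRadical (K R : Type*) [Field K] [Ring R] [Algebra K R] : TwoSidedIdeal R :=
  TwoSidedIdeal.mk' {a | ∀ b : R, LinearMap.trace K R (LinearMap.mulLeft K (a * b)) = 0}
    (fun b => by simp [LinearMap.mulLeft_zero_eq_zero])
    (fun {x y} hx hy b => by
      have : LinearMap.mulLeft K ((x + y) * b) =
          LinearMap.mulLeft K (x * b) + LinearMap.mulLeft K (y * b) := by
        ext; simp [add_mul, mul_assoc]
      rw [this, map_add, hx, hy, add_zero])
    (fun {x} hx b => by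
      have : LinearMap.mulLeft K (-x * b) = -LinearMap.mulLeft K (x * b) := by
        ext; simp [mul_assoc]
      rw [this, map_neg, hx, neg_zero])
    (fun {x y} hy b => by
      rw [mul_assoc, LinearMap.mulLeft_mul, ← Module.End.mul_eq_comp, LinearMap.trace_mul_comm,
        Module.End.mul_eq_comp, ← LinearMap.mulLeft_mul, mul_assoc]
      exact hy _)
    (fun {x y} hx b => by
      rw [mul_assoc]
      exact hx _)

theorem mem_traceRadical {a : R} : a ∈ traceRadical K R ↔
    ∀ b : R, LinearMap.trace K R (LinearMap.mulLeft K (a * b)) = 0 :=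
  TwoSidedIdeal.mem_mk' ..

/-- With L for left multiplication, L(δ(a)b) = [δ, L(ab)] - L(a δ(b)), and a commutator has trace
zero. -/
theorem derivation_mem_traceRadical (δ : R →ₗ[K] R)
    (hδ : ∀ a b, δ (a * b) = δ a * b + a * δ b) {a : R} (ha : a ∈ traceRadical K R) :
    δ a ∈ traceRadical K R := by
  rw [mem_traceRadical] at ha ⊢
  intro b
  have key : LinearMap.mulLeft K (δ a * b) =
      (δ * LinearMap.mulLeft K (a * b) - LinearMap.mulLeft K (a * b) * δ) -
        LinearMap.mulLeft K (a * δ b) := by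
    ext c
    simp only [LinearMap.mulLeft_apply, LinearMap.sub_apply, Module.End.mul_apply, hδ]
    noncomm_ring
  rw [key, map_sub, map_sub, LinearMap.trace_mul_comm, sub_self, ha, sub_zero]

variable [FiniteDimensional K R]

theorem traceRadical_ne_top [CharZero K] [Nontrivial R] : traceRadical K R ≠ ⊤ := by
  intro h
  have h1 : (1 : R) ∈ traceRadical K R := by rw [h]; trivial
  have := mem_traceRadical.mp h1 1
  rw [mul_one, LinearMap.mulLeft_one, LinearMap.trace_id] at this
  exact Module.finrank_pos.ne' (by exact_mod_cast this)

/-- The Jacobson radical is a nilpotent ideal and nilpotent operators have trace zero, so it lies in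
the trace radical. -/
theorem isSemisimpleRing_of_traceRadical_eq_bot (h : traceRadical K R = ⊥) :
    IsSemisimpleRing R := by
  have := IsArtinianRing.of_finite K R
  rw [IsArtinianRing.isSemisimpleRing_iff_jacobson, eq_bot_iff]
  intro a ha
  obtain ⟨n, hn⟩ := IsArtinianRing.isNilpotent_jacobson_bot (R := R)
  have hmem : a ∈ traceRadical K R := by
    rw [mem_traceRadical]
    intro b
    have hab : a * b ∈ Ring.jacobson R := Ideal.mul_mem_right b _ ha
    have hnil : IsNilpotent (a * b) := by
      refine ⟨n, ?_⟩
      have : (a * b) ^ n ∈ (Ideal.jacobson (⊥ : Ideal R)) ^ n := by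
        refine Ideal.pow_mem_pow ?_ n
        rwa [Ideal.jacobson_bot]
      rw [hn] at this
      simpa using this
    exact (LinearMap.isNilpotent_trace_of_isNilpotent
      (hnil.map (Algebra.lmul K R))).eq_zero
  rw [h] at hmem
  exact hmem

/-- Split 1 = f + g along a complementary left ideal; then yg lies in both summands. Writing y = yf
shows that any derivation maps I into itself. -/
theorem TwoSidedIdeal.exists_mul_eq_self [IsSemisimpleRing R] (I : TwoSidedIdeal R) :
    ∃ f ∈ I, ∀ y ∈ I, y * f = y := by
  obtain ⟨J, hJ⟩ := exists_isCompl I.asIdeal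
  have h1 : (1 : R) ∈ I.asIdeal ⊔ J := by rw [hJ.sup_eq_top]; trivial
  obtain ⟨f, hf, g, hg, hfg⟩ := Submodule.mem_sup.mp h1
  refine ⟨f, hf, fun y hy => ?_⟩
  have h2 : y * g = y - y * f := by
    rw [eq_sub_iff_add_eq, add_comm, ← mul_add, hfg, mul_one]
  have h3 : y * g ∈ I.asIdeal ⊓ J := by
    refine ⟨?_, J.mul_mem_left y hg⟩
    rw [h2]
    exact I.asIdeal.sub_mem hy (I.asIdeal.mul_mem_left y hf)
  rw [hJ.inf_eq_bot, Submodule.mem_bot, h2, sub_eq_zero] at h3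
  exact h3.symm

/-- A finite-dimensional algebra in characteristic zero with a derivation that stabilizes no
nontrivial two-sided ideal is simple. -/
theorem IsSimpleRing.of_derivation [CharZero K] [Nontrivial R] (δ : R →ₗ[K] R)
    (hδ : ∀ a b, δ (a * b) = δ a * b + a * δ b)
    (h : ∀ I : TwoSidedIdeal R, (∀ a ∈ I, δ a ∈ I) → I = ⊥ ∨ I = ⊤) : IsSimpleRing R := by
  have hbot : traceRadical K R = ⊥ :=
    (h _ fun a ha => derivation_mem_traceRadical δ hδ ha).resolve_right traceRadical_ne_top
  have := isSemisimpleRing_of_traceRadical_eq_bot hbot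
  refine ⟨⟨fun I => h I fun a ha => ?_⟩⟩
  obtain ⟨f, hf, hI⟩ := I.exists_mul_eq_self
  rw [← hI a ha, hδ]
  exact I.add_mem (I.mul_mem_left _ _ hf) (I.mul_mem_right _ _ ha)

end DerivationSimple

/-! ### Derivations of matrix algebras -/

/-- Every derivation of a matrix algebra is inner. -/
theorem Matrix.exists_eq_commutator_of_derivation {n K : Type*} [Fintype n] [DecidableEq n]
    [Nonempty n] [Field K] (δ : Matrix n n K →ₗ[K] Matrix n n K)
    (hδ : ∀ a b, δ (a * b) = δ a * b + a * δ b) :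
    ∃ x, ∀ s, δ s = x * s - s * x := by
  obtain ⟨o⟩ := ‹Nonempty n›
  let E : n → n → Matrix n n K := fun i j => Matrix.single i j 1
  have hone : ∑ i, E i o * E o i = 1 := by
    simp [E, Matrix.sum_single_eq_diagonal]
  have hleft : ∀ (s : Matrix n n K) i, s * E i o = ∑ k, s k i • E k o := by
    intro s i
    ext a b
    simp [E, Matrix.mul_apply, Matrix.single_apply, Matrix.sum_apply, ite_and]
  have hright : ∀ (s : Matrix n n K) i, E o i * s = ∑ k, s i k • E o k := by
    intro s i
    ext a b
    simp [E, Matrix.mul_apply, Matrix.single_apply, Matrix.sum_apply, ite_and]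
  -- The element ∑ E i o ⊗ E o i commutes with s in the bimodule sense; this is its image under a ⊗
  -- b ↦ δ(a)b.
  have hswap : ∀ s, ∑ i, δ (E i o) * (E o i * s) = ∑ i, δ (s * E i o) * E o i := by
    intro s
    simp only [hleft, hright, map_sum, map_smul, Finset.mul_sum, Finset.sum_mul, mul_smul_comm,
      smul_mul_assoc]
    exact Finset.sum_comm
  refine ⟨∑ i, δ (E i o) * E o i, fun s => ?_⟩
  rw [Finset.sum_mul, Finset.mul_sum]
  simp only [mul_assoc]
  rw [hswap, ← Finset.sum_sub_distrib]
  calc δ s = δ s * ∑ i, E i o * E o i := by rw [hone, mul_one]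
    _ = _ := by
      rw [Finset.mul_sum]
      refine Finset.sum_congr rfl fun i _ => ?_
      rw [hδ]
      noncomm_ring

/-- A complex matrix whose commutator map has no nonzero eigenvalue is the sum of a scalar
matrix and a nilpotent one. -/
theorem Matrix.exists_isNilpotent_sub_smul_one {n : Type*} [Fintype n] [DecidableEq n]
    [Nonempty n] (x : Matrix n n ℂ)
    (hx : ∀ (μ : ℂ) (s : Matrix n n ℂ), x * s - s * x = μ • s → s ≠ 0 → μ = 0) :
    ∃ c : ℂ, IsNilpotent (x - c • (1 : Matrix n n ℂ)) := by
  obtain ⟨c, hc⟩ := IsAlgClosed.exists_root x.charpoly (by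
    rw [Matrix.charpoly_degree_eq_dim]
    exact_mod_cast Fintype.card_ne_zero)
  rw [Polynomial.IsRoot, Matrix.eval_charpoly, ← Matrix.exists_mulVec_eq_zero_iff] at hc
  obtain ⟨v, hv, hxv⟩ := hc
  refine ⟨c, ?_⟩
  set y := x - c • (1 : Matrix n n ℂ) with hy
  have hyv : y.mulVec v = 0 := by
    rw [hy, ← neg_eq_zero, ← Matrix.neg_mulVec, neg_sub, ← hxv, Matrix.smul_one_eq_diagonal]
    rfl
  have hroots : ∀ μ ∈ y.charpoly.roots, μ = 0 := by
    intro μ hμ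
    rw [Polynomial.mem_roots (Matrix.charpoly_monic y).ne_zero, Polynomial.IsRoot,
      Matrix.eval_charpoly, ← Matrix.exists_vecMul_eq_zero_iff] at hμ
    obtain ⟨w, hw, hyw⟩ := hμ
    have hyw' : Matrix.vecMul w y = μ • w := by
      rw [Matrix.vecMul_sub, sub_eq_zero] at hyw
      rw [← hyw, Matrix.scalar_apply, ← Matrix.smul_one_eq_diagonal, Matrix.vecMul_smul,
        Matrix.vecMul_one]
    -- With v a right null vector and w a left μ-eigenvector of y, the rank-one matrix v wᵀ
    -- satisfies [x, v wᵀ] = [y, v wᵀ] = -μ v wᵀ.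
    have hs : Matrix.vecMulVec v w ≠ 0 := by
      obtain ⟨i, hi⟩ := Function.ne_iff.mp hv
      obtain ⟨j, hj⟩ := Function.ne_iff.mp hw
      intro h0
      have := congrFun (congrFun h0 i) j
      exact (mul_ne_zero hi hj) this
    have := hx (-μ) _ (by
      have h1 : x = y + c • (1 : Matrix n n ℂ) := by rw [hy]; abel
      rw [h1, add_mul, mul_add, Matrix.mul_vecMulVec, Matrix.vecMulVec_mul, hyv, hyw']
      simp [Matrix.vecMulVec_smul]) hs
    simpa using this
  have hprod := (IsAlgClosed.splits y.charpoly).eq_prod_roots_of_monic (Matrix.charpoly_monic y)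
  rw [Multiset.eq_replicate_of_mem hroots, Multiset.map_replicate, Multiset.prod_replicate,
    map_zero, sub_zero] at hprod
  refine ⟨Multiset.card y.charpoly.roots, ?_⟩
  have := Matrix.aeval_self_charpoly y
  rw [hprod] at this
  simpa using this

/-! ### Identities checked on ℂ[∂]-generators -/

/-- Induction over a `ℂ[X]`-module spanned by a set `s`. -/
theorem Polynomial.span_smul_induction {M : Type*} [AddCommGroup M] [Module ℂ M] [Module ℂ[X] M]
    [IsScalarTower ℂ ℂ[X] M] {s : Set M} (hs : Submodule.span ℂ[X] s = ⊤) {P : M → Prop}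
    (mem : ∀ x ∈ s, P x) (zero : P 0) (add : ∀ x y, P x → P y → P (x + y))
    (smul : ∀ (c : ℂ) x, P x → P (c • x))
    (X_smul : ∀ x, P x → P ((Polynomial.X : ℂ[X]) • x)) (x : M) : P x := by
  have hx : x ∈ Submodule.span ℂ[X] s := by rw [hs]; trivial
  induction hx using Submodule.span_induction with
  | mem x hx => exact mem x hx
  | zero => exact zero
  | add x y _ _ hx hy => exact add x y hx hy
  | smul p x _ hx =>
    induction p using Polynomial.induction_on' with
    | add p q hp hq => rw [add_smul]; exact add _ _ hp hq
    | monomial n c =>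
      rw [← Polynomial.C_mul_X_pow_eq_monomial, ← Polynomial.smul_eq_C_mul, smul_assoc]
      refine smul _ _ ?_
      induction n with
      | zero => simpa using hx
      | succ n ih => rw [pow_succ', mul_smul]; exact X_smul _ ih

namespace ConformalAlgebra

section Generators

variable {C : Type*} [AddCommGroup C] [Module ℂ C] [Module ℂ[X] C] [IsScalarTower ℂ ℂ[X] C]
  [ConformalAlgebra C]

theorem prod_X_smul_right (n : ℕ) (a b : C) :
    prod n a ((Polynomial.X : ℂ[X]) • b) =
      (Polynomial.X : ℂ[X]) • prod n a b + (n : ℂ) • prod (n - 1) a b := by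
  rw [leibniz, prod_deriv_left, neg_smul]
  abel

/-- The associativity identity for a fixed triple of elements. -/
def AssocAt (f g h : C) : Prop :=
  ∀ m n : ℕ, prod m f (prod n g h) =
    ∑ j ∈ Finset.range (m + 1), (m.choose j : ℂ) • prod (m + n - j) (prod j f g) h

/-- An index shift by (j+1) C(m, j+1) = (m-j) C(m, j); it absorbs the terms produced by ∂ in the
middle argument. -/
theorem sum_choose_mul_smul {M : Type*} [AddCommGroup M] [Module ℂ M] (m : ℕ) (F : ℕ → M) :
    ∑ j ∈ Finset.range (m + 1), ((m.choose j : ℂ) * j) • F j =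
      ∑ j ∈ Finset.range (m + 1), ((m.choose j : ℂ) * (m - j)) • F (j + 1) := by
  rw [Finset.sum_range_succ', Finset.sum_range_succ]
  simp only [Nat.cast_zero, mul_zero, zero_smul, add_zero, sub_self]
  refine Finset.sum_congr rfl fun j hj => ?_
  congr 1
  have h := congrArg (Nat.cast (R := ℂ)) (Nat.choose_succ_right_eq m j)
  rw [Nat.cast_mul, Nat.cast_mul, Nat.cast_sub (Finset.mem_range.mp hj).le] at h
  exact h

theorem sum_choose_pred_smul {M : Type*} [AddCommGroup M] [Module ℂ M] (m : ℕ) (F : ℕ → M) :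
    (m : ℂ) • ∑ j ∈ Finset.range (m - 1 + 1), ((m - 1).choose j : ℂ) • F j =
      ∑ j ∈ Finset.range (m + 1), ((m.choose j : ℂ) * (m - j)) • F j := by
  rcases m with _ | m
  · simp
  · rw [Finset.sum_range_succ _ (m + 1), sub_self, mul_zero, zero_smul, add_zero,
      Nat.add_sub_cancel, Finset.smul_sum]
    refine Finset.sum_congr rfl fun j hj => ?_
    rw [smul_smul]
    congr 1
    have h := congrArg (Nat.cast (R := ℂ)) (Nat.choose_mul_succ_eq m j)
    rw [Nat.cast_mul, Nat.cast_mul, Nat.cast_sub (Finset.mem_range.mp hj).le] at h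
    rw [mul_comm, h]

theorem AssocAt.X_smul_left {f g h : C} (H : AssocAt f g h) :
    AssocAt ((Polynomial.X : ℂ[X]) • f) g h := by
  intro m n
  rcases m with _ | m
  · simp [prod_deriv_left]
  · rw [prod_deriv_left, Nat.add_sub_cancel, H, Finset.sum_range_succ' _ (m + 1), Finset.smul_sum]
    simp only [prod_deriv_left, Nat.cast_zero, neg_zero, zero_smul, map_zero,
      LinearMap.zero_apply, smul_zero, add_zero, map_smul, LinearMap.smul_apply, smul_smul,
      Nat.add_sub_cancel]
    refine Finset.sum_congr rfl fun j _ => ?_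
    rw [show m + 1 + n - (j + 1) = m + n - j by omega]
    congr 1
    have h : ((m + 1 : ℕ) : ℂ) * (m.choose j : ℂ) =
        ((m + 1).choose (j + 1) : ℂ) * ((j + 1 : ℕ) : ℂ) := by
      exact_mod_cast Nat.add_one_mul_choose_eq m j
    linear_combination -h

theorem AssocAt.X_smul_middle {f g h : C} (H : AssocAt f g h) :
    AssocAt f ((Polynomial.X : ℂ[X]) • g) h := by
  intro m n
  have h1 := sum_choose_mul_smul m fun j => prod (m + n - j) (prod (j - 1) f g) h
  simp only [Nat.add_sub_cancel] at h1
  rw [prod_deriv_left, map_smul, H]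
  simp only [prod_X_smul_right, prod_deriv_left, map_add, LinearMap.add_apply, map_smul,
    LinearMap.smul_apply, smul_add, Finset.sum_add_distrib, smul_smul]
  rw [h1, ← Finset.sum_add_distrib, Finset.smul_sum]
  refine Finset.sum_congr rfl fun j hj => ?_
  have hj' : j ≤ m := Nat.lt_succ_iff.mp (Finset.mem_range.mp hj)
  rw [show m + n - j - 1 = m + n - (j + 1) by omega, ← add_smul, smul_smul,
    Nat.cast_sub (by omega)]
  -- For n = 0 the truncated `n - 1` is harmless: its coefficient is zero, and the two coefficients
  -- on the other side cancel.
  rcases n with _ | n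
  · rw [show -((0 : ℕ) : ℂ) * (m.choose j : ℂ) = 0 by simp, zero_smul]
    rw [show (m.choose j : ℂ) * -(((m + 0 : ℕ) : ℂ) - j) + (m.choose j : ℂ) * (m - j) = 0 by
      push_cast; ring, zero_smul]
  · rw [show m + (n + 1) - (j + 1) = m + (n + 1 - 1) - j by omega]
    congr 1
    push_cast
    ring

theorem AssocAt.X_smul_right {f g h : C} (H : AssocAt f g h) :
    AssocAt f g ((Polynomial.X : ℂ[X]) • h) := by
  intro m n
  have h1 := sum_choose_pred_smul m fun j => prod (m - 1 + n - j) (prod j f g) h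
  simp only [prod_X_smul_right, map_add, map_smul, smul_add, Finset.sum_add_distrib,
    smul_smul]
  rw [H, H, H, h1, Finset.smul_sum, Finset.smul_sum, add_assoc, ← Finset.sum_add_distrib]
  congr 1
  · exact Finset.sum_congr rfl fun j _ => smul_comm _ _ _
  refine Finset.sum_congr rfl fun j hj => ?_
  have hj' : j ≤ m := Nat.lt_succ_iff.mp (Finset.mem_range.mp hj)
  rw [Nat.cast_sub (by omega), smul_smul]
  rcases n with _ | n
  · rw [Nat.cast_zero, zero_mul, zero_smul, add_zero]
    rw [show m - 1 + 0 - j = m + 0 - j - 1 by omega, add_zero]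
  -- The term j = m is separated because `m - 1` truncates at m = 0; there the factor m - j
  -- vanishes.
  · rcases hj'.eq_or_lt with rfl | hlt
    · rw [sub_self, mul_zero, zero_smul, zero_add,
        show j + (n + 1 - 1) - j = j + (n + 1) - j - 1 by omega]
      congr 1
      push_cast
      ring
    · rw [show m - 1 + (n + 1) - j = m + (n + 1) - j - 1 by omega,
        show m + (n + 1 - 1) - j = m + (n + 1) - j - 1 by omega, ← add_smul]
      congr 1
      push_cast
      ring

theorem isAssociative_of_span {s : Set C} (hs : Submodule.span ℂ[X] s = ⊤)
    (h : ∀ f ∈ s, ∀ g ∈ s, ∀ h ∈ s, AssocAt f g h) : IsAssociative C := by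
  suffices H : ∀ f g h : C, AssocAt f g h from fun m n f g h => H f g h m n
  intro f
  refine Polynomial.span_smul_induction hs (P := fun f => ∀ g h, AssocAt f g h)
    (fun f hf g => ?_) ?_ ?_ ?_ ?_ f
  · refine Polynomial.span_smul_induction hs (P := fun g => ∀ h, AssocAt f g h)
      (fun g hg k => ?_) ?_ ?_ ?_ ?_ g
    · refine Polynomial.span_smul_induction hs (P := fun k => AssocAt f g k)
        (fun k hk => h f hf g hg k hk) ?_ ?_ ?_ ?_ k
      · intro m n; simp
      · intro x y hx hy m n
        simp only [map_add, hx m n, hy m n, smul_add, Finset.sum_add_distrib]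
      · intro c x hx m n
        simp only [map_smul, hx m n, Finset.smul_sum]
        exact Finset.sum_congr rfl fun j _ => smul_comm _ _ _
      · exact fun x hx => hx.X_smul_right
    · intro k m n; simp
    · intro x y hx hy k m n
      simp only [map_add, LinearMap.add_apply, hx k m n, hy k m n, smul_add,
        Finset.sum_add_distrib]
    · intro c x hx k m n
      simp only [map_smul, LinearMap.smul_apply, hx k m n, Finset.smul_sum]
      exact Finset.sum_congr rfl fun j _ => smul_comm _ _ _
    · exact fun x hx k => (hx k).X_smul_middle
  · intro g k m n; simp
  · intro x y hx hy g k m n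
    simp only [map_add, LinearMap.add_apply, hx g k m n, hy g k m n, smul_add,
      Finset.sum_add_distrib]
  · intro c x hx g k m n
    simp only [map_smul, LinearMap.smul_apply, hx g k m n, Finset.smul_sum]
    exact Finset.sum_congr rfl fun j _ => smul_comm _ _ _
  · exact fun x hx g k => (hx g k).X_smul_left

variable {D : Type*} [AddCommGroup D] [Module ℂ D] [Module ℂ[X] D] [IsScalarTower ℂ ℂ[X] D]
  [ConformalAlgebra D]

/-- A `ℂ[∂]`-linear map that preserves the products of generators preserves all products. -/
theorem map_prod_of_span {s : Set C} (hs : Submodule.span ℂ[X] s = ⊤) (φ : C →ₗ[ℂ[X]] D)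
    (h : ∀ a ∈ s, ∀ b ∈ s, ∀ n, φ (prod n a b) = prod n (φ a) (φ b)) (n : ℕ) (a b : C) :
    φ (prod n a b) = prod n (φ a) (φ b) := by
  suffices H : ∀ (a b : C) (n : ℕ), φ (prod n a b) = prod n (φ a) (φ b) from H a b n
  intro a
  refine Polynomial.span_smul_induction hs
    (P := fun a => ∀ (b : C) (n : ℕ), φ (prod n a b) = prod n (φ a) (φ b)) (fun a ha b => ?_) ?_ ?_ ?_ ?_ a
  · refine Polynomial.span_smul_induction hs
      (P := fun b => ∀ n : ℕ, φ (prod n a b) = prod n (φ a) (φ b)) (fun b hb => h a ha b hb) ?_ ?_ ?_ ?_ b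
    · simp
    · intro x y hx hy n; simp [hx, hy]
    · intro c x hx n; simp [hx]
    · intro x hx n
      rw [prod_X_smul_right, map_add, map_smul, LinearMap.map_smul_of_tower, hx, hx, map_smul,
        prod_X_smul_right]
  · simp
  · intro x y hx hy b n; simp [hx, hy]
  · intro c x hx b n; simp [hx]
  · intro x hx b n
    rw [prod_deriv_left, LinearMap.map_smul_of_tower, map_smul, prod_deriv_left, hx]

end Generators

/-! ### Transport along isomorphisms -/

section Transport

variable {C : Type*} [AddCommGroup C] [Module ℂ C] [Module ℂ[X] C] [IsScalarTower ℂ ℂ[X] C]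
  [ConformalAlgebra C]
  {D : Type*} [AddCommGroup D] [Module ℂ D] [Module ℂ[X] D] [IsScalarTower ℂ ℂ[X] D]
  [ConformalAlgebra D]

theorem Iso.map_prod' (φ : Iso C D) (n : ℕ) (a b : C) :
    φ.toLinearEquiv (prod n a b) = prod n (φ.toLinearEquiv a) (φ.toLinearEquiv b) :=
  φ.map_prod n a b

/-- The inverse of an isomorphism of conformal algebras. -/
noncomputable def Iso.symm (φ : Iso C D) : Iso D C where
  toLinearEquiv := φ.toLinearEquiv.symm
  map_prod n a b := by
    change φ.toLinearEquiv.symm _ = prod n (φ.toLinearEquiv.symm a) (φ.toLinearEquiv.symm b)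
    rw [LinearEquiv.symm_apply_eq, φ.map_prod', LinearEquiv.apply_symm_apply,
      LinearEquiv.apply_symm_apply]

theorem Iso.isAssociative (φ : Iso C D) (h : IsAssociative C) : IsAssociative D := by
  intro m n f g k
  apply φ.symm.toLinearEquiv.injective
  simp only [map_sum, Iso.map_prod']
  rw [h]
  refine Finset.sum_congr rfl fun j _ => ?_
  rw [← LinearEquiv.coe_coe φ.symm.toLinearEquiv, LinearMap.map_smul_of_tower]
  simp only [LinearEquiv.coe_coe, Iso.map_prod']

theorem Iso.isUnital (φ : Iso C D) (h : IsUnital C) : IsUnital D := by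
  obtain ⟨e, he, hd⟩ := h
  refine ⟨φ.toLinearEquiv e, fun f => ?_, ?_⟩
  · obtain ⟨f, rfl⟩ := φ.toLinearEquiv.surjective f
    rw [← φ.map_prod', he]
  · rw [← hd]
    unfold localityDegree
    simp only [← φ.map_prod', LinearEquiv.map_eq_zero_iff]

theorem Iso.isSimple (φ : Iso C D) (h : IsSimple C) : IsSimple D := by
  obtain ⟨⟨n, a, b, hab⟩, hI⟩ := h
  refine ⟨⟨n, φ.toLinearEquiv a, φ.toLinearEquiv b, ?_⟩, fun I hid => ?_⟩
  · rwa [← φ.map_prod', Ne, LinearEquiv.map_eq_zero_iff]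
  · have hcomap : IsIdeal (I.comap φ.toLinearEquiv.toLinearMap) := by
      intro n a x hx
      simp only [Submodule.mem_comap, LinearEquiv.coe_coe, φ.map_prod'] at hx ⊢
      exact hid n _ _ hx
    have hmap := Submodule.map_comap_eq_of_surjective
      (f := φ.toLinearEquiv.toLinearMap) φ.toLinearEquiv.surjective I
    rcases hI _ hcomap with h0 | h0
    · left; rw [← hmap, h0, Submodule.map_bot]
    · right; rw [← hmap, h0, Submodule.map_top, LinearEquiv.range]

theorem Iso.finite (φ : Iso C D) [Module.Finite ℂ[X] C] : Module.Finite ℂ[X] D :=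
  Module.Finite.equiv φ.toLinearEquiv

end Transport

/-! ### Current algebras: associativity, identity, simplicity -/

section Current

variable {A : Type*} [Ring A] [Algebra ℂ A]

theorem prod_tmul (n : ℕ) (p q : ℂ[X]) (a b : A) :
    prod n (p ⊗ₜ[ℂ] a : Cur A) (q ⊗ₜ[ℂ] b : Cur A) = polyProd n p q ⊗ₜ[ℂ] (a * b) := rfl

theorem span_one_tmul :
    Submodule.span ℂ[X] (Set.range fun a : A => ((1 : ℂ[X]) ⊗ₜ[ℂ] a : Cur A)) = ⊤ := by
  rw [eq_top_iff]
  rintro z -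
  induction z using TensorProduct.induction_on with
  | zero => exact Submodule.zero_mem _
  | add x y hx hy => exact Submodule.add_mem _ hx hy
  | tmul p a =>
    rw [← mul_one p, ← smul_eq_mul, ← TensorProduct.smul_tmul']
    exact Submodule.smul_mem _ _ (Submodule.subset_span ⟨a, rfl⟩)

theorem cur_isAssociative : IsAssociative (Cur A) := by
  refine isAssociative_of_span span_one_tmul ?_
  rintro _ ⟨a, rfl⟩ _ ⟨b, rfl⟩ _ ⟨c, rfl⟩ m n
  simp only
  rw [Finset.sum_range_succ']
  simp only [cur_prod_generators, Nat.add_one_ne_zero, if_false, map_zero, LinearMap.zero_apply,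
    smul_zero, Finset.sum_const_zero, zero_add, Nat.choose_zero_right, Nat.cast_one, one_smul,
    if_true, Nat.sub_zero]
  rcases n with _ | n
  · simp [cur_prod_generators, mul_assoc]
  · simp

theorem one_tmul_ne_zero {a : A} (ha : a ≠ 0) : ((1 : ℂ[X]) ⊗ₜ[ℂ] a : Cur A) ≠ 0 := by
  intro h
  have := congrArg (TensorProduct.lid ℂ A ∘ (Polynomial.lcoeff ℂ 0).rTensor A) h
  simp at this
  exact ha this

theorem cur_isUnital [Nontrivial A] : IsUnital (Cur A) := by
  refine ⟨(1 : ℂ[X]) ⊗ₜ (1 : A), fun f => ?_, ?_⟩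
  · induction f using TensorProduct.induction_on with
    | zero => simp
    | add x y hx hy => rw [map_add, hx, hy]
    | tmul p a => rw [prod_tmul, one_mul]; simp [polyProd_apply]
  · have h : {N : ℕ | ∀ n, N ≤ n → prod n ((1 : ℂ[X]) ⊗ₜ[ℂ] (1 : A) : Cur A)
        ((1 : ℂ[X]) ⊗ₜ[ℂ] (1 : A) : Cur A) = 0} = Set.Ici 1 := by
      ext N
      simp only [Set.mem_ofPred_eq, Set.mem_Ici, cur_prod_generators]
      refine ⟨fun h => ?_, fun h n hn => if_neg (by omega)⟩
      by_contra hN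
      have := h 0 (by omega)
      rw [if_pos rfl, one_mul] at this
      exact one_tmul_ne_zero one_ne_zero this
    rw [localityDegree, h, csInf_Ici]

/-- The coefficient of `∂ⁿ` of an element of the current algebra. -/
noncomputable def curCoeff (A : Type*) [Ring A] [Algebra ℂ A] (n : ℕ) : Cur A →ₗ[ℂ] A :=
  (TensorProduct.lid ℂ A).toLinearMap ∘ₗ (Polynomial.lcoeff ℂ n).rTensor A

theorem curCoeff_tmul (n : ℕ) (p : ℂ[X]) (a : A) :
    curCoeff A n (p ⊗ₜ a) = p.coeff n • a := by
  simp [curCoeff]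

theorem exists_curCoeff_ne_zero {z : Cur A} (hz : z ≠ 0) : ∃ n, curCoeff A n z ≠ 0 := by
  by_contra! h
  refine hz ((TensorProduct.equivFinsuppOfBasisLeft
    (Polynomial.basisMonomials ℂ) (N := A)).map_eq_zero_iff.mp ?_)
  ext n
  rw [TensorProduct.equivFinsuppOfBasisLeft_apply, Finsupp.zero_apply, ← h n, curCoeff]
  rfl

/-- The n-th product by 1 ⊗ a differentiates n times in ∂, and the zeroth product into 1 ⊗ b sets ∂
= 0, so an ideal containing z contains each of its coefficients, up to a nonzero factor, as a
generator. -/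
theorem prod_one_tmul_prod (n : ℕ) (a b : A) (z : Cur A) :
    prod 0 (prod n ((1 : ℂ[X]) ⊗ₜ[ℂ] a : Cur A) z) ((1 : ℂ[X]) ⊗ₜ[ℂ] b : Cur A) =
      (1 : ℂ[X]) ⊗ₜ[ℂ] ((n.factorial : ℂ) • (a * curCoeff A n z * b)) := by
  induction z using TensorProduct.induction_on with
  | zero => simp
  | add x y hx hy =>
    simp only [map_add, LinearMap.add_apply, hx, hy, mul_add, add_mul, smul_add,
      TensorProduct.tmul_add]
  | tmul p c =>
    have h1 : polyProd n 1 p = Polynomial.derivative^[n] p := by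
      rw [polyProd_apply, Finset.sum_range_succ', Finset.sum_eq_zero]
      · simp
      · intro i _
        rw [Function.iterate_succ_apply, Polynomial.derivative_one, iterate_map_zero]
        simp
    rw [prod_tmul, prod_tmul, h1, curCoeff_tmul]
    have h2 : polyProd 0 (Polynomial.derivative^[n] p) 1 =
        ((n.factorial : ℂ) * p.coeff n) • (1 : ℂ[X]) := by
      rw [polyProd_apply]
      simp [← Polynomial.coeff_zero_eq_eval_zero, Polynomial.coeff_iterate_derivative,
        Nat.descFactorial_self]
    rw [h2, TensorProduct.smul_tmul]
    simp [smul_smul]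

/-- The current algebra of a simple algebra is simple. -/
theorem cur_isSimple [IsSimpleRing A] : IsSimple (Cur A) := by
  refine ⟨⟨0, (1 : ℂ[X]) ⊗ₜ (1 : A), (1 : ℂ[X]) ⊗ₜ (1 : A), ?_⟩, fun I hI => ?_⟩
  · rw [cur_prod_generators, if_pos rfl, one_mul]
    exact one_tmul_ne_zero one_ne_zero
  · rw [or_iff_not_imp_left]
    intro hne
    obtain ⟨z, hz, hz0⟩ := Submodule.exists_mem_ne_zero_of_ne_bot hne
    obtain ⟨n, hn⟩ := exists_curCoeff_ne_zero hz0
    let J : TwoSidedIdeal A := TwoSidedIdeal.mk' {a | ((1 : ℂ[X]) ⊗ₜ[ℂ] a : Cur A) ∈ I}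
      (by simp)
      (fun hx hy => by
        simp only [Set.mem_ofPred_eq, TensorProduct.tmul_add]
        exact I.add_mem hx hy)
      (fun hx => by
        simp only [Set.mem_ofPred_eq, TensorProduct.tmul_neg]
        exact I.neg_mem hx)
      (fun {x y} hy => by
        have := (hI 0 ((1 : ℂ[X]) ⊗ₜ[ℂ] x) _ hy).1
        rwa [cur_prod_generators, if_pos rfl] at this)
      (fun {x y} hx => by
        have := (hI 0 ((1 : ℂ[X]) ⊗ₜ[ℂ] y) _ hx).2
        rwa [cur_prod_generators, if_pos rfl] at this)
    have hJ : ∀ a, a ∈ J ↔ ((1 : ℂ[X]) ⊗ₜ[ℂ] a : Cur A) ∈ I := fun a =>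
      TwoSidedIdeal.mem_mk' ..
    have hmem : (n.factorial : ℂ) • curCoeff A n z ∈ J := by
      rw [hJ]
      have h1 := (hI 0 ((1 : ℂ[X]) ⊗ₜ[ℂ] (1 : A)) _
        (hI n ((1 : ℂ[X]) ⊗ₜ[ℂ] (1 : A)) z hz).1).2
      rwa [prod_one_tmul_prod, one_mul, mul_one] at h1
    have htop : J = ⊤ := by
      refine (IsSimpleRing.simple.eq_bot_or_eq_top J).resolve_left fun h0 => ?_
      rw [h0, TwoSidedIdeal.mem_bot, smul_eq_zero] at hmem
      exact hmem.elim (by exact_mod_cast n.factorial_ne_zero) hn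
    rw [eq_top_iff, ← span_one_tmul, Submodule.span_le]
    rintro _ ⟨a, rfl⟩
    exact (hJ a).mp (htop ▸ trivial)

end Current

end ConformalAlgebra

/-! ### Weyl operators -/

theorem Polynomial.derivative_surjective_complex (p : ℂ[X]) :
    ∃ q : ℂ[X], Polynomial.derivative q = p := by
  induction p using Polynomial.induction_on' with
  | add p q hp hq =>
    obtain ⟨p', rfl⟩ := hp
    obtain ⟨q', rfl⟩ := hq
    exact ⟨p' + q', map_add _ _ _⟩
  | monomial n c =>
    refine ⟨Polynomial.monomial (n + 1) (c / (n + 1)), ?_⟩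
    rw [Polynomial.derivative_monomial]
    congr 1
    push_cast
    field_simp [Nat.cast_add_one_ne_zero n]

/-- If Dᵏc = 0 and yˡ = 0, every binomial term of (D - y)ᵏ⁺ˡ contains yˡ or Dᵏ. -/
theorem Commute.isNilpotent_at_sub {M : Type*} [AddCommGroup M] [Module ℂ M]
    {D y : Module.End ℂ M} (h : Commute D y) (hy : IsNilpotent y) (c : M)
    (hD : ∃ k, (D ^ k) c = 0) : ∃ k, ((D - y) ^ k) c = 0 := by
  obtain ⟨k, hk⟩ := hD
  obtain ⟨l, hl⟩ := hy
  refine ⟨k + l, ?_⟩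
  rw [sub_eq_neg_add, h.symm.neg_left.add_pow, LinearMap.sum_apply]
  refine Finset.sum_eq_zero fun m _ => ?_
  rw [← (Nat.cast_commute ((k + l).choose m) _).eq, Module.End.mul_apply, Module.End.mul_apply]
  by_cases hm : l ≤ m
  · rw [neg_pow, pow_eq_zero_of_le hm hl]
    simp
  · rw [show k + l - m = (l - m) + k by omega, pow_add, Module.End.mul_apply, hk]
    simp

namespace ConformalAlgebra

variable {C : Type*} [AddCommGroup C] [Module ℂ C] [Module ℂ[X] C] [IsScalarTower ℂ ℂ[X] C]
  [ConformalAlgebra C]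

/-- A locally nilpotent operator that satisfies the Weyl relation with `∂` and is compatible
with the products in the way the first product with a conformal identity is. -/
structure IsWeylOperator (D : Module.End ℂ C) : Prop where
  X_smul : ∀ c, D ((Polynomial.X : ℂ[X]) • c) = (Polynomial.X : ℂ[X]) • D c + c
  prod : ∀ n a b, D (prod n a b) = prod (n + 1) a b + prod n (D a) b
  locallyNilpotent : ∀ c, ∃ k, (D ^ k) c = 0

namespace IsWeylOperator

variable {D : Module.End ℂ C}

theorem smul (hD : IsWeylOperator D) (p : ℂ[X]) (c : C) :
    D (p • c) = p • D c + Polynomial.derivative p • c := by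
  induction p using Polynomial.induction_on' with
  | add p q hp hq =>
    simp only [add_smul, map_add, hp, hq]
    abel
  | monomial n r =>
    rw [← Polynomial.C_mul_X_pow_eq_monomial, ← Polynomial.smul_eq_C_mul]
    simp only [smul_assoc, map_smul, ← smul_add]
    congr 1
    induction n with
    | zero => simp
    | succ n ih =>
      rw [pow_succ', mul_smul, hD.X_smul, ih, Polynomial.derivative_mul,
        Polynomial.derivative_X, one_mul, smul_add, add_smul, mul_smul, mul_smul]
      abel

/-- Since D(q • v) = q' • v for v ∈ ker D, the span of ker D is contained in its own image under D.
By induction on k, if Dᵏ⁺¹c = 0 then Dc = Dw with w in the span, and c - w ∈ ker D. -/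
theorem span_ker (hD : IsWeylOperator D) :
    Submodule.span ℂ[X] (LinearMap.ker D : Set C) = ⊤ := by
  have hint : ∀ u ∈ Submodule.span ℂ[X] (LinearMap.ker D : Set C),
      ∃ w ∈ Submodule.span ℂ[X] (LinearMap.ker D : Set C), D w = u := by
    intro u hu
    -- D is not ℂ[∂]-linear, so the induction runs over sums of elements p • v with v ∈ ker D.
    induction hu using Submodule.closure_induction with
    | zero => exact ⟨0, Submodule.zero_mem _, map_zero _⟩
    | add x y _ _ hx hy =>
      obtain ⟨x', hx', rfl⟩ := hx
      obtain ⟨y', hy', rfl⟩ := hy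
      exact ⟨x' + y', Submodule.add_mem _ hx' hy', map_add _ _ _⟩
    | smul_mem p v hv =>
      obtain ⟨q, rfl⟩ := Polynomial.derivative_surjective_complex p
      refine ⟨q • v, Submodule.smul_mem _ _ (Submodule.subset_span hv), ?_⟩
      rw [hD.smul, LinearMap.mem_ker.mp hv, smul_zero, zero_add]
  have hpow : ∀ (k : ℕ) (c : C), (D ^ k) c = 0 →
      c ∈ Submodule.span ℂ[X] (LinearMap.ker D : Set C) := by
    intro k
    induction k with
    | zero =>
      intro c hc
      rw [pow_zero, Module.End.one_apply] at hc
      rw [hc]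
      exact Submodule.zero_mem _
    | succ k ih =>
      intro c hc
      rw [pow_succ, Module.End.mul_apply] at hc
      obtain ⟨w, hw, hwc⟩ := hint _ (ih _ hc)
      rw [← sub_add_cancel c w]
      refine Submodule.add_mem _ (Submodule.subset_span ?_) hw
      rw [SetLike.mem_coe, LinearMap.mem_ker, map_sub, hwc, sub_self]
  rw [eq_top_iff]
  intro c _
  obtain ⟨k, hk⟩ := hD.locallyNilpotent c
  exact hpow k c hk

/-- Because (∂c')₍₀₎ = 0, this replaces any element by one of ker D with the same zeroth product. -/
theorem exists_eq_add_X_smul (hD : IsWeylOperator D) (c : C) :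
    ∃ v c', D v = 0 ∧ c = v + (Polynomial.X : ℂ[X]) • c' := by
  refine Polynomial.span_smul_induction hD.span_ker
    (P := fun c => ∃ v c', D v = 0 ∧ c = v + (Polynomial.X : ℂ[X]) • c') ?_ ?_ ?_ ?_ ?_ c
  · exact fun v hv => ⟨v, 0, hv, by simp⟩
  · exact ⟨0, 0, map_zero _, by simp⟩
  · rintro _ _ ⟨v, c, hv, rfl⟩ ⟨w, d, hw, rfl⟩
    exact ⟨v + w, c + d, by simp [hv, hw], by rw [smul_add]; abel⟩
  · rintro r _ ⟨v, c, hv, rfl⟩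
    exact ⟨r • v, r • c, by simp [hv], by rw [smul_add, smul_comm]⟩
  · exact fun x _ => ⟨0, x, map_zero _, by simp⟩

/-- On ker D the zeroth product thus determines all the others. -/
theorem prod_succ (hD : IsWeylOperator D) {v : C} (hv : D v = 0) (n : ℕ) (b : C) :
    ConformalAlgebra.prod (n + 1) v b = D (ConformalAlgebra.prod n v b) := by
  rw [hD.prod, hv, map_zero, LinearMap.zero_apply, add_zero]

theorem prod_eq_zero (hD : IsWeylOperator D) {v : C} (hv : D v = 0)
    (h0 : ConformalAlgebra.prod 0 v = 0) (n : ℕ) : ConformalAlgebra.prod n v = 0 := by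
  induction n with
  | zero => exact h0
  | succ n ih => ext b; rw [hD.prod_succ hv, ih]; simp

/-- A Weyl operator has no nonzero eigenvalue on `ℂ[∂]`-linear operators. -/
theorem eq_zero_of_commutator_eq_smul (hD : IsWeylOperator D) {t : Module.End ℂ C}
    (ht : ∀ c, t ((Polynomial.X : ℂ[X]) • c) = (Polynomial.X : ℂ[X]) • t c) {μ : ℂ}
    (h : D * t - t * D = μ • t) (ht0 : t ≠ 0) : μ = 0 := by
  by_contra hμ
  refine ht0 (LinearMap.ext fun c => ?_)
  refine Polynomial.span_smul_induction hD.span_ker (P := fun c => t c = 0) ?_ ?_ ?_ ?_ ?_ c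
  · intro v hv
    -- t maps ker D into the μ-eigenspace of D, which local nilpotency kills when μ ≠ 0.
    have h1 : D (t v) = μ • t v := by
      have := LinearMap.congr_fun h v
      simpa [LinearMap.mem_ker.mp hv] using this
    have h2 : ∀ k : ℕ, (D ^ k) (t v) = μ ^ k • t v := by
      intro k
      induction k with
      | zero => simp
      | succ k ih =>
        rw [pow_succ', Module.End.mul_apply, ih, map_smul, h1, smul_smul, pow_succ]
    obtain ⟨k, hk⟩ := hD.locallyNilpotent (t v)
    rw [h2, smul_eq_zero] at hk
    exact hk.resolve_left (pow_ne_zero k hμ)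
  · simp
  · intro x y hx hy; rw [map_add, hx, hy, add_zero]
  · intro r x hx; rw [map_smul, hx, smul_zero]
  · intro x hx; rw [ht, hx, smul_zero]

end IsWeylOperator

/-! ### The algebra of zeroth products -/

section Associative

variable (hC : IsAssociative C)
include hC

theorem IsAssociative.prod_zero_prod (n : ℕ) (f g h : C) :
    prod 0 f (prod n g h) = prod n (prod 0 f g) h := by
  rw [hC]; simp

theorem IsAssociative.prod_one_prod (n : ℕ) (f g h : C) :
    prod 1 f (prod n g h) = prod (n + 1) (prod 0 f g) h + prod n (prod 1 f g) h := by
  rw [hC, Finset.sum_range_succ, Finset.sum_range_one, add_comm 1 n]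
  simp

theorem IsAssociative.isWeylOperator {e : C} (he : ∀ f : C, prod 0 e f = f)
    (he1 : ∀ n, 1 ≤ n → prod n e e = 0) : IsWeylOperator (prod 1 e) where
  X_smul c := by rw [prod_X_smul_right, he]; simp
  prod n a b := by rw [hC.prod_one_prod, he]
  locallyNilpotent c := by
    -- Since e₍₁₎e = 0, the powers of e₍₁₎ are the products e₍ₖ₎, and locality of e with c makes
    -- them vanish on c eventually.
    have h : ∀ k, ((prod 1 e) ^ k) c = prod k e c := by
      intro k
      induction k with
      | zero => simp [he]
      | succ k ih =>
        rw [pow_succ', Module.End.mul_apply, ih, hC.prod_one_prod, he, he1 1 le_rfl]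
        simp
    obtain ⟨N, hN⟩ := locality e c
    exact ⟨N, by rw [h, hN N le_rfl]⟩

end Associative

theorem prod_zero_smul_right (a : C) (p : ℂ[X]) (b : C) : prod 0 a (p • b) = p • prod 0 a b := by
  induction p using Polynomial.induction_on' with
  | add p q hp hq => simp only [add_smul, map_add, hp, hq]
  | monomial n r =>
    rw [← Polynomial.C_mul_X_pow_eq_monomial, ← Polynomial.smul_eq_C_mul]
    simp only [smul_assoc, map_smul]
    congr 1
    induction n with
    | zero => simp
    | succ n ih =>
      rw [pow_succ', mul_smul, prod_X_smul_right, ih, mul_smul]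
      simp

/-- The algebra of left multiplications by the zeroth product. -/
noncomputable def zeroModes (hC : IsAssociative C) {e : C} (he : ∀ f : C, prod 0 e f = f) :
    Subalgebra ℂ (Module.End ℂ C) :=
  (LinearMap.range (prod 0 : C →ₗ[ℂ] Module.End ℂ C)).toSubalgebra
    ⟨e, LinearMap.ext he⟩
    (by
      rintro _ _ ⟨a, rfl⟩ ⟨b, rfl⟩
      exact ⟨prod 0 a b, LinearMap.ext fun c => (hC.prod_zero_prod 0 a b c).symm⟩)

section ZeroModes

variable {hC : IsAssociative C} {e : C} {he : ∀ f : C, prod 0 e f = f}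

variable (hC he) in
/-- Left multiplication by the zeroth product, as an element of the algebra it generates. -/
noncomputable def zeroMode (a : C) : zeroModes hC he := ⟨prod 0 a, a, rfl⟩

theorem exists_zeroMode_eq (s : zeroModes hC he) : ∃ a, zeroMode hC he a = s := by
  obtain ⟨_, a, rfl⟩ := s
  exact ⟨a, rfl⟩

theorem zeroModes_smul (s : zeroModes hC he) (p : ℂ[X]) (c : C) :
    (s : Module.End ℂ C) (p • c) = p • (s : Module.End ℂ C) c := by
  obtain ⟨a, rfl⟩ := exists_zeroMode_eq s
  exact prod_zero_smul_right a p c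

theorem zeroModes_prod (s : zeroModes hC he) (n : ℕ) (a b : C) :
    (s : Module.End ℂ C) (prod n a b) = prod n ((s : Module.End ℂ C) a) b := by
  obtain ⟨g, rfl⟩ := exists_zeroMode_eq s
  exact hC.prod_zero_prod n g a b

/-- As (∂a)₍₀₎ = 0, the zeroth products of a finite ℂ[∂]-generating set already span over ℂ. -/
instance [Module.Finite ℂ[X] C] : FiniteDimensional ℂ (zeroModes hC he) := by
  obtain ⟨S, hS⟩ := Module.Finite.fg_top (R := ℂ[X]) (M := C)
  have hle : LinearMap.range (prod 0 : C →ₗ[ℂ] Module.End ℂ C) ≤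
      Submodule.span ℂ ((prod 0 : C →ₗ[ℂ] Module.End ℂ C) '' S) := by
    rintro _ ⟨a, rfl⟩
    refine Polynomial.span_smul_induction hS (P := fun a => (prod 0 a : Module.End ℂ C) ∈
      Submodule.span ℂ ((prod 0 : C →ₗ[ℂ] Module.End ℂ C) '' S)) ?_ ?_ ?_ ?_ ?_ a
    · exact fun x hx => Submodule.subset_span ⟨x, hx, rfl⟩
    · rw [map_zero]; exact Submodule.zero_mem _
    · intro x y hx hy; rw [map_add]; exact Submodule.add_mem _ hx hy
    · intro c x hx; rw [map_smul]; exact Submodule.smul_mem _ _ hx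
    · intro x _
      have : (prod 0 ((Polynomial.X : ℂ[X]) • x) : Module.End ℂ C) = 0 := by
        ext b; simp [prod_deriv_left]
      rw [this]
      exact Submodule.zero_mem _
  have : FiniteDimensional ℂ (Submodule.span ℂ ((prod 0 : C →ₗ[ℂ] Module.End ℂ C) '' S)) :=
    FiniteDimensional.span_of_finite ℂ (S.finite_toSet.image _)
  exact Submodule.finiteDimensional_of_le hle

/-- Associativity gives [D, a₍₀₎] = (Da)₍₀₎ - (a₍₀₎e - a)₍₁₎. The element a₍₀₎e - a has zero zeroth
product; writing it as v + ∂c with v ∈ ker D, all products by v vanish and (∂c)₍₁₎ = -c₍₀₎ is again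
a zeroth product. -/
theorem commutator_mem_zeroModes (hD : IsWeylOperator (prod 1 e : Module.End ℂ C))
    (s : zeroModes hC he) :
    (prod 1 e : Module.End ℂ C) * s - s * (prod 1 e : Module.End ℂ C) ∈ zeroModes hC he := by
  obtain ⟨a, rfl⟩ := exists_zeroMode_eq s
  obtain ⟨v, c, hv, hvc⟩ := hD.exists_eq_add_X_smul (prod 0 a e - a)
  have h0 : (prod 0 v : Module.End ℂ C) = 0 := by
    ext b
    have h1 : prod 0 (prod 0 a e - a) b = 0 := by
      rw [map_sub, LinearMap.sub_apply, ← hC.prod_zero_prod, he, sub_self]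
    rw [hvc, map_add, LinearMap.add_apply, prod_deriv_left] at h1
    simpa using h1
  have h1 := hD.prod_eq_zero hv h0 1
  refine ⟨prod 1 e a + c, LinearMap.ext fun b => ?_⟩
  have h2 : prod 1 (prod 0 a e - a) b = -prod 0 c b := by
    rw [hvc, map_add, LinearMap.add_apply, h1, prod_deriv_left]
    simp
  change prod 0 (prod 1 e a + c) b = prod 1 e (prod 0 a b) - prod 0 a (prod 1 e b)
  rw [hC.prod_one_prod, hC.prod_zero_prod, he, map_add, LinearMap.add_apply]
  rw [map_sub, LinearMap.sub_apply, sub_eq_iff_eq_add] at h2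
  rw [h2]
  simp only [zero_add]
  abel

/-- The derivation of the algebra of zeroth products given by the commutator with the first
product with the identity. -/
noncomputable def zeroModesDerivation (hD : IsWeylOperator (prod 1 e : Module.End ℂ C)) :
    zeroModes hC he →ₗ[ℂ] zeroModes hC he where
  toFun s := ⟨_, commutator_mem_zeroModes hD s⟩
  map_add' s t := Subtype.ext <| by
    simp only [Subalgebra.coe_add, mul_add, add_mul]
    abel
  map_smul' c s := Subtype.ext <| by
    simp [smul_sub]

theorem coe_zeroModesDerivation (hD : IsWeylOperator (prod 1 e : Module.End ℂ C))
    (s : zeroModes hC he) : (zeroModesDerivation hD s : Module.End ℂ C) =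
      (prod 1 e : Module.End ℂ C) * s - s * (prod 1 e : Module.End ℂ C) := rfl

theorem zeroModesDerivation_mul (hD : IsWeylOperator (prod 1 e : Module.End ℂ C))
    (s t : zeroModes hC he) : zeroModesDerivation hD (s * t) =
      zeroModesDerivation hD s * t + s * zeroModesDerivation hD t := by
  apply Subtype.ext
  simp only [coe_zeroModesDerivation, Subalgebra.coe_add, Subalgebra.coe_mul]
  noncomm_ring

theorem zeroModesDerivation_apply (hD : IsWeylOperator (prod 1 e : Module.End ℂ C))
    (s : zeroModes hC he) (c : C) : prod 1 e ((s : Module.End ℂ C) c) =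
      (zeroModesDerivation hD s : Module.End ℂ C) c + (s : Module.End ℂ C) (prod 1 e c) := by
  rw [coe_zeroModesDerivation]
  simp

/-- The `ℂ[∂]`-submodule generated by the action of a two-sided ideal of zeroth products. -/
noncomputable def idealSpan (J : TwoSidedIdeal (zeroModes hC he)) : Submodule ℂ[X] C :=
  Submodule.span ℂ[X] {x | ∃ s ∈ J, ∃ c, x = (s : Module.End ℂ C) c}

theorem apply_mem_idealSpan {J : TwoSidedIdeal (zeroModes hC he)} {s : zeroModes hC he}
    (hs : s ∈ J) (c : C) : (s : Module.End ℂ C) c ∈ idealSpan J :=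
  Submodule.subset_span ⟨s, hs, c, rfl⟩

/-- No scalar case is needed: elements of J are ℂ[∂]-linear, so p • s(c) = s(p • c). -/
theorem idealSpan_induction {J : TwoSidedIdeal (zeroModes hC he)} {P : C → Prop} (zero : P 0)
    (add : ∀ x y, P x → P y → P (x + y)) (apply : ∀ s ∈ J, ∀ c, P ((s : Module.End ℂ C) c))
    {x : C} (hx : x ∈ idealSpan J) : P x := by
  induction hx using Submodule.closure_induction with
  | zero => exact zero
  | add x y _ _ hx hy => exact add x y hx hy
  | smul_mem p x hx =>
    obtain ⟨s, hs, c, rfl⟩ := hx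
    rw [← zeroModes_smul]
    exact apply s hs _

/-- Stability of J makes the span D-stable, and a₍ₙ₊₁₎x = D(a₍ₙ₎x) - (Da)₍ₙ₎x then reduces left
products to the zeroth. Right products stay inside because s(c)₍ₙ₎a = s(c₍ₙ₎a). -/
theorem isIdeal_idealSpan (hD : IsWeylOperator (prod 1 e : Module.End ℂ C))
    {J : TwoSidedIdeal (zeroModes hC he)} (hJ : ∀ s ∈ J, zeroModesDerivation hD s ∈ J) :
    IsIdeal (idealSpan J) := by
  have hstable : ∀ x ∈ idealSpan J, prod 1 e x ∈ idealSpan J := by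
    intro x hx
    refine idealSpan_induction (P := fun x => prod 1 e x ∈ idealSpan J) ?_ ?_ ?_ hx
    · rw [map_zero]; exact Submodule.zero_mem _
    · intro x y hx hy; rw [map_add]; exact Submodule.add_mem _ hx hy
    · intro s hs c
      rw [zeroModesDerivation_apply hD]
      exact Submodule.add_mem _ (apply_mem_idealSpan (hJ s hs) c) (apply_mem_idealSpan hs _)
  intro n a x hx
  constructor
  · induction n generalizing a with
    | zero =>
      refine idealSpan_induction (P := fun x => prod 0 a x ∈ idealSpan J) ?_ ?_ ?_ hx
      · rw [map_zero]; exact Submodule.zero_mem _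
      · intro x y hx hy; rw [map_add]; exact Submodule.add_mem _ hx hy
      · exact fun s hs c => apply_mem_idealSpan (J.mul_mem_left (zeroMode hC he a) s hs) c
    | succ n ih =>
      have h := hD.prod n a x
      rw [← sub_eq_iff_eq_add] at h
      rw [← h]
      exact Submodule.sub_mem _ (hstable _ (ih a)) (ih _)
  · refine idealSpan_induction (P := fun x => prod n x a ∈ idealSpan J) ?_ ?_ ?_ hx
    · rw [map_zero]; exact Submodule.zero_mem _
    · intro x y hx hy
      rw [map_add, LinearMap.add_apply]; exact Submodule.add_mem _ hx hy
    · intro s hs c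
      rw [← zeroModes_prod]
      exact apply_mem_idealSpan hs _

/-- For a δ-stable J, the ideal J·C is 0 or C. If it is C, it contains e; since s(c)₍₀₎ = s ∘ c₍₀₎ ∈
J, the identity e₍₀₎ lies in J. -/
theorem isSimpleRing_zeroModes [Module.Finite ℂ[X] C] (hS : IsSimple C)
    (hD : IsWeylOperator (prod 1 e : Module.End ℂ C)) : IsSimpleRing (zeroModes hC he) := by
  have hnt : Nontrivial C := by
    obtain ⟨⟨n, a, b, h⟩, -⟩ := hS
    exact ⟨_, _, h⟩
  refine IsSimpleRing.of_derivation (zeroModesDerivation hD) (zeroModesDerivation_mul hD)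
    fun J hJ => ?_
  rcases hS.2 _ (isIdeal_idealSpan hD hJ) with h | h
  · left
    rw [eq_bot_iff]
    intro s hs
    rw [TwoSidedIdeal.mem_bot]
    refine Subtype.ext (LinearMap.ext fun c => ?_)
    have := apply_mem_idealSpan hs c
    rwa [h, Submodule.mem_bot] at this
  · right
    have hmem : ∀ x ∈ idealSpan J, zeroMode hC he x ∈ J := by
      intro x hx
      refine idealSpan_induction (P := fun x => zeroMode hC he x ∈ J) ?_ ?_ ?_ hx
      · convert J.zero_mem
        exact Subtype.ext (map_zero (prod 0 : C →ₗ[ℂ] Module.End ℂ C))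
      · intro x y hx hy
        convert J.add_mem hx hy
        exact Subtype.ext (map_add (prod 0 : C →ₗ[ℂ] Module.End ℂ C) x y)
      · intro s hs c
        convert J.mul_mem_right s (zeroMode hC he c) hs
        exact Subtype.ext (LinearMap.ext fun b => (zeroModes_prod s 0 c b).symm)
    rw [← TwoSidedIdeal.one_mem_iff]
    convert hmem e (h ▸ trivial)
    exact Subtype.ext (LinearMap.ext fun b => (he b).symm)

end ZeroModes

/-! ### Identification with a current algebra -/

/-- The left annihilator of a simple associative conformal algebra vanishes. -/
theorem IsSimple.eq_zero_of_prod_eq_zero (hS : IsSimple C) (hC : IsAssociative C) {c : C}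
    (hc : ∀ n, prod n c = 0) : c = 0 := by
  let N : Submodule ℂ[X] C :=
    { carrier := {c | ∀ n, prod n c = 0}
      zero_mem' := fun n => map_zero _
      add_mem' := fun hx hy n => by rw [map_add, hx n, hy n, add_zero]
      smul_mem' := fun p x hx => by
        induction p using Polynomial.induction_on' with
        | add p q hp hq => intro n; rw [add_smul, map_add, hp n, hq n, add_zero]
        | monomial k r =>
          intro n
          rw [← Polynomial.C_mul_X_pow_eq_monomial, ← Polynomial.smul_eq_C_mul, smul_assoc,
            map_smul]
          suffices h : prod n ((Polynomial.X ^ k : ℂ[X]) • x) = 0 by rw [h, smul_zero]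
          induction k generalizing n with
          | zero => simpa using hx n
          | succ k ih =>
            ext b
            rw [pow_succ', mul_smul, prod_deriv_left, ih]
            simp }
  have hN : IsIdeal N := by
    intro n a x hx
    constructor
    -- In the associativity formula for a₍ₙ₎(x₍ₖ₎b) = 0 the terms j < n vanish by induction, leaving
    -- (a₍ₙ₎x)₍ₖ₎b = 0.
    · induction n using Nat.strong_induction_on with
      | _ n ih =>
        intro k
        ext b
        have h := hC n k a x b
        rw [hx k, LinearMap.zero_apply, map_zero, Finset.sum_range_succ, Finset.sum_eq_zero,
          zero_add, Nat.choose_self, Nat.cast_one, one_smul, Nat.add_sub_cancel_left] at h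
        · exact h.symm
        · intro j hj
          rw [ih j (Finset.mem_range.mp hj)]
          simp
    · rw [hx n, LinearMap.zero_apply]
      exact N.zero_mem
  rcases hS.2 N hN with h | h
  · have : c ∈ N := hc
    rwa [h, Submodule.mem_bot] at this
  · obtain ⟨n, a, b, hab⟩ := hS.1
    have : a ∈ N := h ▸ trivial
    rw [this n] at hab
    exact absurd rfl hab

/-- A surjective homomorphism out of a simple conformal algebra to a nontrivial one is an
isomorphism. -/
noncomputable def Iso.ofSurjective {C : Type*} [AddCommGroup C] [Module ℂ C] [Module ℂ[X] C]
    [IsScalarTower ℂ ℂ[X] C] [ConformalAlgebra C]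
    {D : Type*} [AddCommGroup D] [Module ℂ D] [Module ℂ[X] D]
    [IsScalarTower ℂ ℂ[X] D] [ConformalAlgebra D] [Nontrivial D] (hS : IsSimple C)
    (φ : C →ₗ[ℂ[X]] D) (hφ : ∀ n a b, φ (prod n a b) = prod n (φ a) (φ b))
    (hsurj : Function.Surjective φ) : Iso C D where
  toLinearEquiv := LinearEquiv.ofBijective φ ⟨by
    have hI : IsIdeal (LinearMap.ker φ) := by
      intro n a x hx
      rw [LinearMap.mem_ker] at hx
      simp [LinearMap.mem_ker, hφ, hx]
    rcases hS.2 _ hI with h | h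
    · exact LinearMap.ker_eq_bot.mp h
    · exfalso
      obtain ⟨d, hd⟩ := exists_ne (0 : D)
      obtain ⟨c, rfl⟩ := hsurj d
      rw [LinearMap.ker_eq_top.mp h] at hd
      exact hd rfl, hsurj⟩
  map_prod := hφ

/-- If a Weyl operator commutes with all zeroth products, then its kernel identifies a simple
algebra with the current algebra of the algebra of its zeroth products. -/
theorem IsWeylOperator.nonempty_iso_cur {hC : IsAssociative C} {e : C}
    {he : ∀ f : C, ConformalAlgebra.prod 0 e f = f} {D : Module.End ℂ C}
    (hD : IsWeylOperator D) (hS : IsSimple C)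
    (hcomm : ∀ a b, D (ConformalAlgebra.prod 0 a b) = ConformalAlgebra.prod 0 a (D b))
    {A : Type*} [Ring A] [Algebra ℂ A] [IsSimpleRing A] (Φ : A ≃ₐ[ℂ] zeroModes hC he) :
    Nonempty (Iso C (Cur A)) := by
  have hnt : Nontrivial C := by
    obtain ⟨⟨n, a, b, h⟩, -⟩ := hS
    exact ⟨_, _, h⟩
  have hinj : ∀ v w : C, D v = 0 → D w = 0 →
      (ConformalAlgebra.prod 0 v : Module.End ℂ C) = ConformalAlgebra.prod 0 w → v = w := by
    intro v w hv hw h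
    rw [← sub_eq_zero]
    refine hS.eq_zero_of_prod_eq_zero hC (hD.prod_eq_zero ?_ ?_)
    · rw [map_sub, hv, hw, sub_zero]
    · rw [map_sub, sub_eq_zero]; exact h
  have hex : ∀ a : A, ∃ v, D v = 0 ∧
      (ConformalAlgebra.prod 0 v : Module.End ℂ C) = Φ a := by
    intro a
    obtain ⟨c, hc⟩ := (Φ a).2
    obtain ⟨v, c', hv, rfl⟩ := hD.exists_eq_add_X_smul c
    refine ⟨v, hv, ?_⟩
    rw [← hc]
    ext b
    simp [prod_deriv_left]
  -- τ inverts v ↦ v₍₀₎ on ker D; by `hinj` it inherits linearity and multiplicativity from Φ.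
  choose τ hτ hτΦ using hex
  let τ' : A →ₗ[ℂ] C :=
    { toFun := τ
      map_add' := fun a b => hinj _ _ (hτ _) (by rw [map_add, hτ, hτ, add_zero])
        (by rw [hτΦ, map_add, map_add, hτΦ, hτΦ]; rfl)
      map_smul' := fun r a => hinj _ _ (hτ _) (by simp [hτ])
        (by rw [hτΦ, map_smul, RingHom.id_apply, map_smul, hτΦ]; rfl) }
  have hmul : ∀ a b, τ (a * b) = ConformalAlgebra.prod 0 (τ a) (τ b) := by
    intro a b
    refine hinj _ _ (hτ _) (by rw [hcomm, hτ, map_zero]) ?_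
    rw [hτΦ, map_mul, Subalgebra.coe_mul, ← hτΦ, ← hτΦ]
    exact LinearMap.ext fun c => hC.prod_zero_prod 0 _ _ c
  have hpos : ∀ (n : ℕ) (a b : A), ConformalAlgebra.prod (n + 1) (τ a) (τ b) = 0 := by
    intro n a b
    induction n with
    | zero => rw [hD.prod_succ (hτ a), hcomm, hτ, map_zero]
    | succ n ih => rw [hD.prod_succ (hτ a), ih, map_zero]
  let Θ : Cur A →ₗ[ℂ[X]] C := LinearMap.liftBaseChange ℂ[X] τ'
  have hΘ : ∀ a, Θ ((1 : ℂ[X]) ⊗ₜ a) = τ a := fun a => by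
    simp only [Θ, LinearMap.liftBaseChange_tmul, one_smul]
    rfl
  have hΘprod := map_prod_of_span span_one_tmul Θ (by
    rintro _ ⟨a, rfl⟩ _ ⟨b, rfl⟩ n
    simp only [hΘ, cur_prod_generators]
    rcases n with _ | n
    · rw [if_pos rfl, hΘ, hmul]
    · rw [if_neg n.succ_ne_zero, map_zero, hpos])
  have hsurj : Function.Surjective Θ := by
    rw [← LinearMap.range_eq_top, eq_top_iff, ← hD.span_ker, Submodule.span_le]
    intro v hv
    refine ⟨(1 : ℂ[X]) ⊗ₜ Φ.symm (zeroMode hC he v), ?_⟩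
    rw [hΘ]
    refine hinj _ _ (hτ _) hv ?_
    rw [hτΦ, AlgEquiv.apply_symm_apply]
    rfl
  -- Injectivity uses simplicity of Cur A, not of C.
  exact ⟨(Iso.ofSurjective cur_isSimple Θ hΘprod hsurj).symm⟩

/-! ### The classification -/

/-- A simple unital associative conformal algebra of finite type is the current algebra of a
matrix algebra. -/
theorem exists_iso_cur_matrix [Module.Finite ℂ[X] C] (hC : IsAssociative C) (hU : IsUnital C)
    (hS : IsSimple C) : ∃ n : ℕ, 1 ≤ n ∧ Nonempty (Iso C (Cur (Matrix (Fin n) (Fin n) ℂ))) := by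
  obtain ⟨e, he, hdeg⟩ := hU
  have he1 : ∀ n, 1 ≤ n → prod n e e = 0 := by
    have h := Nat.sInf_mem (s := {N : ℕ | ∀ n, N ≤ n → prod n e e = 0}) (locality e e)
    rw [localityDegree] at hdeg
    rwa [hdeg] at h
  have hD := hC.isWeylOperator he he1
  have := isSimpleRing_zeroModes (hC := hC) (he := he) hS hD
  obtain ⟨n, hn, ⟨Φ⟩⟩ :=
    IsSimpleRing.exists_algEquiv_matrix_of_isAlgClosed ℂ (zeroModes hC he)
  refine ⟨n, NeZero.one_le, ?_⟩
  have : IsSimpleRing (Matrix (Fin n) (Fin n) ℂ) := inferInstance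
  obtain ⟨x, hx⟩ := Matrix.exists_eq_commutator_of_derivation
    (Φ.toLinearMap ∘ₗ zeroModesDerivation hD ∘ₗ Φ.symm.toLinearMap) (fun a b => by
      simp [zeroModesDerivation_mul])
  have hcom : ∀ s : zeroModes hC he,
      zeroModesDerivation hD s = Φ.symm x * s - s * Φ.symm x := by
    intro s
    apply Φ.injective
    have := hx (Φ s)
    simpa using this
  -- An eigenvector of [x, ·] corresponds to a ℂ[∂]-linear operator t with [D, t] = μt, which forces
  -- μ = 0.
  obtain ⟨c, hc⟩ := Matrix.exists_isNilpotent_sub_smul_one x (by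
    intro μ s h hs
    refine hD.eq_zero_of_commutator_eq_smul (t := (Φ.symm s : zeroModes hC he))
      (fun c => zeroModes_smul _ _ c) ?_ ?_
    · rw [← coe_zeroModesDerivation hD, hcom, ← map_mul, ← map_mul, ← map_sub, h, map_smul]
      rfl
    · simpa using hs)
  set y : zeroModes hC he := Φ.symm (x - c • 1) with hy
  have hynil : IsNilpotent (y : Module.End ℂ C) :=
    (hc.map Φ.symm).map (zeroModes hC he).val
  have hcomy : ∀ s : zeroModes hC he, zeroModesDerivation hD s = y * s - s * y := by
    intro s
    rw [hcom, hy, map_sub, map_smul, map_one, sub_mul, mul_sub, smul_mul_assoc, one_mul,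
      mul_smul_comm, mul_one]
    abel
  -- [D, y] = δ(y) = [y, y] = 0, so local nilpotency survives subtracting y.
  have hDy : Commute (prod 1 e : Module.End ℂ C) y := by
    rw [Commute, SemiconjBy, ← sub_eq_zero, ← coe_zeroModesDerivation hD, hcomy, sub_self]
    rfl
  have hD' : IsWeylOperator ((prod 1 e : Module.End ℂ C) - (y : Module.End ℂ C)) :=
    { X_smul := fun c => by
        simp only [LinearMap.sub_apply, hD.X_smul, zeroModes_smul, smul_sub]
        abel
      prod := fun n a b => by
        simp only [LinearMap.sub_apply, hD.prod, zeroModes_prod, map_sub]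
        abel
      locallyNilpotent := fun c => hDy.isNilpotent_at_sub hynil c (hD.locallyNilpotent c) }
  refine hD'.nonempty_iso_cur hS (fun a b => ?_) Φ.symm
  have h := LinearMap.congr_fun (congrArg Subtype.val (hcomy (zeroMode hC he a))) b
  rw [coe_zeroModesDerivation hD] at h
  change prod 1 e (prod 0 a b) - prod 0 a (prod 1 e b) =
    (y : Module.End ℂ C) (prod 0 a b) - prod 0 a ((y : Module.End ℂ C) b) at h
  rw [LinearMap.sub_apply, LinearMap.sub_apply, map_sub]
  rw [sub_eq_sub_iff_add_eq_add] at h ⊢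
  rw [h]
  abel

end ConformalAlgebra

theorem theorem4p2 (C : Type*) [AddCommGroup C] [Module ℂ C] [Module ℂ[X] C]
    [IsScalarTower ℂ ℂ[X] C] [ConformalAlgebra C] :
    (ConformalAlgebra.IsAssociative C ∧ ConformalAlgebra.IsUnital C ∧
        ConformalAlgebra.IsSimple C ∧ Module.Finite ℂ[X] C) ↔
      ∃ n : ℕ, 1 ≤ n ∧
        Nonempty (ConformalAlgebra.Iso C
          (ConformalAlgebra.Cur (Matrix (Fin n) (Fin n) ℂ))) := by
  constructor
  · rintro ⟨hC, hU, hS, hF⟩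
    exact ConformalAlgebra.exists_iso_cur_matrix hC hU hS
  · rintro ⟨n, hn, ⟨φ⟩⟩
    have : NeZero n := ⟨by omega⟩
    exact ⟨φ.symm.isAssociative ConformalAlgebra.cur_isAssociative,
      φ.symm.isUnital ConformalAlgebra.cur_isUnital,
      φ.symm.isSimple ConformalAlgebra.cur_isSimple, φ.symm.finite⟩
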